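/- Let $V$ be a finite-dimensional real vector space with a finite increasing filtration $W$, nondegenerate $(-1)^w$-symmetric bilinear forms $\langle\,,\rangle_w$ on $Gr^W_w$, and Hodge numbers $h^{p,q}$; let $\mathcal M$ be the classifying space of mixed Hodge structures $(F,W)$ on $V$ with these Hodge numbers and graded-polarized by these forms, $\check{\mathcal M}$ its compact dual, and $\mathfrak g_{\mathbb C}$ the Lie algebra of the group of automorphisms of $V_{\mathbb C}$ preserving $W$ and the forms on $Gr^W$. Let $U$ be the upper half-plane, $\Delta$ the unit disc, $\Delta^*=\Delta\setminus\{0\}$. Let $\mathcal V\to\Delta^{*r}$ be a variation of graded-polarized mixed Hodge structure with unipotent monodromy, given by a holomorphic horizontal period map $F:U^r\to\mathcal M$ with $F(z+e_j)=e^{N_j}.F(z)$, where $N_1,\dots,N_r\in\mathfrak g_{\mathbb C}$ are real, nilpotent and commute. Put $N(z)=\sum_j z_jN_j$ and $s_j=e^{2\pi i z_j}$. Suppose that $\mathcal V$ is admissible, i.e. the map $\Delta^{*r}\to\check{\mathcal M}$ induced by $z\mapsto e^{-N(z)}.F(z)$ extends holomorphically to $\Delta^r\to\check{\mathcal M}$,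 with value $F_\infty$ at $0$ (the limit Hodge filtration); the relative weight filtrations $M(N_j,W)$ exist; and there is one filtration $M$ which is the relative weight filtration $M(N,W)$ for every $N$ in the open cone $\{\sum_j\lambda_jN_j\mid\lambda_j>0\}$. Let $V_{\mathbb C}=\bigoplus I^{p,q}$ be the Deligne bigrading of the limit mixed Hodge structure $(F_\infty,M)$, let $\mathfrak g^{a,b}$ be the set of $X\in\mathfrak g_{\mathbb C}$ with $X(I^{p,q})\subseteq I^{p+a,q+b}$ for all $p,q$, and $\mathfrak q=\bigoplus_{a<0,\,b}\mathfrak g^{a,b}$. Let $$F(z)=e^{N(z)}e^{\Gamma(s)}.F_\infty$$ be the local normal form of the period map near $s=0$, where $\Gamma$ is a $\mathfrak q$-valued holomorphic function on a polydisc around $0\in\mathbb C^r$ with $\Gamma(0)=0$. Then for any choice of values $z_j=z_j(s)$ of $\frac{1}{2\pi i}\log s_j$, for $s\in\Delta^{*r}$ near $0$, with $|\mathrm{Re}\,z_j(s)|\le C\,(1+|\log|s_j||)^k$ for some constants $C$ and $k$ (for instance, branches of the logarithm with branch cuts along rays, for which $\mathrm{Re}\,z_j$ is bounded), one has $$\lim_{s\to0,\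 s\in\Delta^{*r}}\mathrm{Ad}\big(e^{\sum_j z_jN_j}\big)\,\Gamma(s)=0 .$$ -/

import Mathlib

open Filter Topology

noncomputable section

namespace HodgeLimit

variable {E : Type*} [NormedAddCommGroup E] [NormedSpace ℂ E] {r : ℕ}

/-- The discrete data of a classifying space of graded-polarized mixed Hodge structures.
`E` is the complexification of the real vector space `V`, which is recovered as the fixed
space of `conj`. The weight filtration `W` of `V` is given by the `conj`-stable subspaces
`W k` of `E`. The form `Q w` on `Gr^W_w` is given by its pull-back to `W w`: a bilinear form
whose radical is exactly `W (w - 1)`. -/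
structure PolarizedData (E : Type*) [NormedAddCommGroup E] [NormedSpace ℂ E] where
  conj : E →ₛₗ[starRingEnd ℂ] E
  conj_conj : ∀ v, conj (conj v) = v
  W : ℤ → Submodule ℂ E
  W_mono : Monotone W
  W_bot : ∃ k, W k = ⊥
  W_top : ∃ k, W k = ⊤
  W_conj : ∀ k, ∀ v ∈ W k, conj v ∈ W k
  Q : (w : ℤ) → ↥(W w) →ₗ[ℂ] ↥(W w) →ₗ[ℂ] ℂ
  Q_symm : ∀ w u v, Q w v u = (-1 : ℂ) ^ w * Q w u v
  Q_real : ∀ w (u v : ↥(W w)),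
    Q w ⟨conj u, W_conj w u u.2⟩ ⟨conj v, W_conj w v v.2⟩ = starRingEnd ℂ (Q w u v)
  Q_nondeg : ∀ w (u : ↥(W w)), (∀ v, Q w u v = 0) ↔ (u : E) ∈ W (w - 1)
  /-- the Hodge numbers; `h p q` belongs to the weight `w = p + q` -/
  h : ℤ → ℤ → ℕ
  h_symm : ∀ p q, h p q = h q p
  h_finite : ∀ w, {p : ℤ | h p (w - p) ≠ 0}.Finite
  h_sum : ∀ w, Module.finrank ℂ (W w) = Module.finrank ℂ (W (w - 1)) + ∑ᶠ p, h p (w - p)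

namespace PolarizedData

variable (D : PolarizedData E)

/-- The subspace of `Gr^W_w` induced by `A ⊆ E`, represented by its preimage in `W w`. -/
def ind (A : Submodule ℂ E) (w : ℤ) : Submodule ℂ E := (A ⊓ D.W w) ⊔ D.W (w - 1)

/-- The complex conjugate of a subspace (`conj` is an involution). -/
def conjSub (A : Submodule ℂ E) : Submodule ℂ E := A.comap D.conj

/-- Points of the compact dual of the classifying space: finite decreasing filtrations of `E`
which induce on each `Gr^W_w` a filtration with the given Hodge numbers that satisfies the first
bilinear relation. -/
structure InCompactDual (F : ℤ → Submodule ℂ E) : Prop where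
  anti : Antitone F
  top : ∃ p, F p = ⊤
  bot : ∃ p, F p = ⊥
  dim : ∀ w p, Module.finrank ℂ (D.ind (F p) w)
    = Module.finrank ℂ (D.ind (F (p + 1)) w) + D.h p (w - p)
  orth : ∀ w p q, w < p + q → ∀ u v : ↥(D.W w),
    (u : E) ∈ D.ind (F p) w → (v : E) ∈ D.ind (F q) w → D.Q w u v = 0

/-- Points of the classifying space: `(F, W)` is a mixed Hodge structure, i.e.
`Gr^W_w = F^p ⊕ conj F^{w+1-p}` for all `w`, `p`, with the given Hodge numbers, and each
`Gr^W_w` is polarized by `Q w`: on `H^{p,q} = F^p ∩ conj F^q`, `p + q = w`, the hermitian form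
`i^{p-q} Q(u, conj u)` is positive definite. -/
structure InClassifyingSpace (F : ℤ → Submodule ℂ E) : Prop extends D.InCompactDual F where
  disjoint : ∀ w p, D.ind (F p) w ⊓ D.ind (D.conjSub (F (w + 1 - p))) w = D.W (w - 1)
  span : ∀ w p, D.ind (F p) w ⊔ D.ind (D.conjSub (F (w + 1 - p))) w = D.W w
  pos : ∀ w p q, p + q = w → ∀ u : ↥(D.W w),
    (u : E) ∈ D.ind (F p) w → (u : E) ∈ D.ind (D.conjSub (F q)) w → (u : E) ∉ D.W (w - 1) →
    0 < (Complex.I ^ (p - q) * D.Q w u ⟨D.conj u, D.W_conj w u u.2⟩).re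

/-- The Lie algebra of the complex group of automorphisms of `E` which preserve `W` and act on
each `Gr^W_w` by isometries of `Q w`. -/
def lieG : Submodule ℂ (E →L[ℂ] E) where
  carrier := {X | ∃ hX : ∀ w, ∀ v ∈ D.W w, X v ∈ D.W w, ∀ w (u v : ↥(D.W w)),
    D.Q w ⟨X u, hX w u u.2⟩ v + D.Q w u ⟨X v, hX w v v.2⟩ = 0}
  zero_mem' := by
    refine ⟨fun w v _ => by simp, fun w u v => ?_⟩
    have h0 : ∀ h : (0 : E) ∈ D.W w, (⟨0, h⟩ : ↥(D.W w)) = 0 := fun _ => rfl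
    simp [h0]
  add_mem' := by
    rintro X Y ⟨hX, hX'⟩ ⟨hY, hY'⟩
    refine ⟨fun w v hv => (D.W w).add_mem (hX w v hv) (hY w v hv), fun w u v => ?_⟩
    have key : ∀ x : ↥(D.W w), ∀ h, (⟨(X + Y) x, h⟩ : ↥(D.W w))
        = ⟨X x, hX w x x.2⟩ + ⟨Y x, hY w x x.2⟩ := fun _ _ => rfl
    rw [key, key, map_add, map_add, LinearMap.add_apply]
    linear_combination hX' w u v + hY' w u v
  smul_mem' := by
    rintro c X ⟨hX, hX'⟩
    refine ⟨fun w v hv => (D.W w).smul_mem c (hX w v hv), fun w u v => ?_⟩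
    have key : ∀ x : ↥(D.W w), ∀ h, (⟨(c • X) x, h⟩ : ↥(D.W w))
        = c • ⟨X x, hX w x x.2⟩ := fun _ _ => rfl
    rw [key, key, map_smul, map_smul, LinearMap.smul_apply, smul_eq_mul, smul_eq_mul]
    linear_combination c * hX' w u v

end PolarizedData

/-- The product of upper half-planes. -/
def upperHalf (r : ℕ) : Set (Fin r → ℂ) := {z | ∀ j, 0 < (z j).im}

/-- The open polydisc of radius `ρ`. -/
def polydisc (r : ℕ) (ρ : ℝ) : Set (Fin r → ℂ) := {s | ∀ j, ‖s j‖ < ρ}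

/-- The product of punctured unit discs. -/
def puncturedPolydisc (r : ℕ) : Set (Fin r → ℂ) := {s | ∀ j, s j ≠ 0 ∧ ‖s j‖ < 1}

/-- The covering map `s_j = exp(2 π i z_j)`. -/
def cover (z : Fin r → ℂ) : Fin r → ℂ := fun j => Complex.exp (2 * Real.pi * Complex.I * z j)

/-- `N(z) = ∑ z_j N_j`. -/
def monoSum (N : Fin r → E →L[ℂ] E) (z : Fin r → ℂ) : E →L[ℂ] E := ∑ j, z j • N j

/-- The action of an endomorphism on (the members of) a filtration. -/
def act (g : E →L[ℂ] E) (A : Submodule ℂ E) : Submodule ℂ E := A.map (g : E →ₗ[ℂ] E)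

/-- Holomorphy on `O` of a map into a variety of flags of `E`, which is a homogeneous space of
`GL(E)`: locally the map is given by letting a holomorphic `GL(E)`-valued function act on a
fixed flag. -/
def HolomorphicFlag (O : Set (Fin r → ℂ)) (F : (Fin r → ℂ) → ℤ → Submodule ℂ E) : Prop :=
  ∀ z₀ ∈ O, ∃ g : (Fin r → ℂ) → E →L[ℂ] E, ∀ᶠ z in 𝓝 z₀,
    DifferentiableAt ℂ g z ∧ IsUnit (g z) ∧ ∀ p, F z p = act (g z) (F z₀ p)

/-- Griffiths horizontality on `O`: partial derivatives of holomorphic sections of `F^p` are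
sections of `F^{p-1}`. -/
def Horizontal (O : Set (Fin r → ℂ)) (F : (Fin r → ℂ) → ℤ → Submodule ℂ E) : Prop :=
  ∀ (p : ℤ) (O' : Set (Fin r → ℂ)), IsOpen O' → O' ⊆ O → ∀ v : (Fin r → ℂ) → E,
    DifferentiableOn ℂ v O' → (∀ z ∈ O', v z ∈ F z p) →
    ∀ z ∈ O', ∀ j, fderiv ℂ v z (Pi.single j 1) ∈ F z (p - 1)

/-- A variation of graded-polarized mixed Hodge structure over the product of `r` punctured
discs with unipotent monodromy: its period map `F`, lifted to the product of upper half-planes,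
and the logarithms `N j` of its local monodromy transformations `T_j = exp (N j)`. -/
structure Variation (D : PolarizedData E) (r : ℕ) where
  N : Fin r → E →L[ℂ] E
  N_mem : ∀ j, N j ∈ D.lieG
  N_real : ∀ j v, N j (D.conj v) = D.conj (N j v)
  N_nilp : ∀ j, IsNilpotent (N j)
  N_comm : ∀ i j, Commute (N i) (N j)
  F : (Fin r → ℂ) → ℤ → Submodule ℂ E
  F_mem : ∀ z ∈ upperHalf r, D.InClassifyingSpace (F z)
  F_holo : HolomorphicFlag (upperHalf r) F
  F_horiz : Horizontal (upperHalf r) F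
  F_mono : ∀ z ∈ upperHalf r, ∀ j p,
    F (z + Pi.single j 1) p = act (NormedSpace.exp (N j)) (F z p)

/-- `M` is the relative weight filtration `M(N, W)`: `N M_k ⊆ M_{k-2}`, and `M` induces on each
`Gr^W_w` the monodromy weight filtration of `N` centered at `w`, i.e. `N^l` induces isomorphisms
`Gr^M_{w+l} Gr^W_w → Gr^M_{w-l} Gr^W_w`. -/
structure IsRelativeWeight (D : PolarizedData E) (N : E →L[ℂ] E) (M : ℤ → Submodule ℂ E) :
    Prop where
  mono : Monotone M
  bot : ∃ k, M k = ⊥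
  top : ∃ k, M k = ⊤
  shift : ∀ k, ∀ v ∈ M k, N v ∈ M (k - 2)
  inj : ∀ (w : ℤ) (l : ℕ), ∀ x ∈ D.ind (M (w + l)) w,
    (N ^ l) x ∈ D.ind (M (w - l - 1)) w → x ∈ D.ind (M (w + l - 1)) w
  surj : ∀ (w : ℤ) (l : ℕ), ∀ y ∈ D.ind (M (w - l)) w,
    ∃ x ∈ D.ind (M (w + l)) w, y - (N ^ l) x ∈ D.ind (M (w - l - 1)) w

/-- `Finf` is the limit Hodge filtration of the variation: the map induced by
`z ↦ exp(-N(z)) F(z)` on the product of punctured discs extends to a holomorphic map from the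
unit polydisc to the compact dual, with value `Finf` at the origin. -/
def Variation.IsLimit {D : PolarizedData E} (𝒱 : Variation D r) (Finf : ℤ → Submodule ℂ E) :
    Prop :=
  ∃ ψ : (Fin r → ℂ) → ℤ → Submodule ℂ E,
    HolomorphicFlag (polydisc r 1) ψ ∧
    (∀ s ∈ polydisc r 1, D.InCompactDual (ψ s)) ∧
    (∀ z ∈ upperHalf r, ∀ p,
      ψ (cover z) p = act (NormedSpace.exp (-monoSum 𝒱.N z)) (𝒱.F z p)) ∧
    ψ 0 = Finf

/-- The variation is admissible, with limit Hodge filtration `Finf` and monodromy weight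
filtration `M`: the limit Hodge filtration exists and equals `Finf`, the relative weight
filtrations `M(N_j, W)` exist, and `M` is the relative weight filtration `M(N, W)` of
every `N` in the open monodromy cone `{∑ λ_j N_j | λ_j > 0}`. -/
structure Variation.IsAdmissible {D : PolarizedData E} (𝒱 : Variation D r)
    (Finf M : ℤ → Submodule ℂ E) : Prop where
  limit : 𝒱.IsLimit Finf
  rel_each : ∀ j, ∃ M', IsRelativeWeight D (𝒱.N j) M'
  rel_cone : ∀ lam : Fin r → ℝ, (∀ j, 0 < lam j) →
    IsRelativeWeight D (monoSum 𝒱.N (fun j => (lam j : ℂ))) M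

/-- `I` is the Deligne bigrading of the mixed Hodge structure `(F, M)`. -/
structure IsDeligneBigrading (D : PolarizedData E) (F M : ℤ → Submodule ℂ E)
    (I : ℤ → ℤ → Submodule ℂ E) : Prop where
  internal : DirectSum.IsInternal (fun a : ℤ × ℤ => I a.1 a.2)
  hodge : ∀ p, F p = ⨆ (a : ℤ) (b : ℤ) (_ : p ≤ a), I a b
  weight : ∀ k, M k = ⨆ (a : ℤ) (b : ℤ) (_ : a + b ≤ k), I a b
  conj : ∀ p q, I p q ⊔ (⨆ (a : ℤ) (b : ℤ) (_ : a < p ∧ b < q), I a b)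
    = D.conjSub (I q p) ⊔ (⨆ (a : ℤ) (b : ℤ) (_ : a < p ∧ b < q), I a b)

/-- The component `𝔤^{a,b}` of the Lie algebra. -/
def gPiece (D : PolarizedData E) (I : ℤ → ℤ → Submodule ℂ E) (a b : ℤ) :
    Submodule ℂ (E →L[ℂ] E) where
  carrier := {X | X ∈ D.lieG ∧ ∀ p q, ∀ v ∈ I p q, X v ∈ I (p + a) (q + b)}
  zero_mem' := ⟨D.lieG.zero_mem, fun p q v _ => by simp⟩
  add_mem' := fun hX hY => ⟨D.lieG.add_mem hX.1 hY.1,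
    fun p q v hv => (I (p + a) (q + b)).add_mem (hX.2 p q v hv) (hY.2 p q v hv)⟩
  smul_mem' := fun c _ hX => ⟨D.lieG.smul_mem c hX.1,
    fun p q v hv => (I (p + a) (q + b)).smul_mem c (hX.2 p q v hv)⟩

/-- `𝔮 = ⊕_{a < 0, b} 𝔤^{a,b}`. -/
def qSub (D : PolarizedData E) (I : ℤ → ℤ → Submodule ℂ E) : Submodule ℂ (E →L[ℂ] E) :=
  ⨆ (a : ℤ) (b : ℤ) (_ : a < 0), gPiece D I a b

/-- `Γ` gives the local normal form `F(z) = exp(N(z)) exp(Γ(s)) Finf` of the period map near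
`s = 0`: it is holomorphic and `𝔮`-valued near the origin, and vanishes there. -/
def Variation.IsLocalNormalForm {D : PolarizedData E} (𝒱 : Variation D r)
    (Finf : ℤ → Submodule ℂ E) (I : ℤ → ℤ → Submodule ℂ E)
    (Γ : (Fin r → ℂ) → E →L[ℂ] E) : Prop :=
  Γ 0 = 0 ∧ ∃ ρ : ℝ, 0 < ρ ∧
    DifferentiableOn ℂ Γ (polydisc r ρ) ∧
    (∀ s ∈ polydisc r ρ, Γ s ∈ qSub D I) ∧
    ∀ z ∈ upperHalf r, cover z ∈ polydisc r ρ → ∀ p,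
      𝒱.F z p = act (NormedSpace.exp (monoSum 𝒱.N z) * NormedSpace.exp (Γ (cover z))) (Finf p)

/-- `Ad(exp X) Y = exp(X) Y exp(-X)`. -/
def adExp (X Y : E →L[ℂ] E) : E →L[ℂ] E := NormedSpace.exp X * Y * NormedSpace.exp (-X)

/-- A choice, for `s` near `0` in the product of punctured discs, of values
`z_j(s) = log(s_j) / (2 π i)` whose arguments `2 π Re z_j(s)` grow at most like a power of
`log |s_j|`. For branches of the logarithm cut along rays, the arguments are bounded. -/
def IsBranchChoice (z : (Fin r → ℂ) → Fin r → ℂ) : Prop :=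
  (∀ᶠ s in 𝓝[puncturedPolydisc r] 0, cover (z s) = s) ∧
  ∃ (C : ℝ) (k : ℕ), ∀ᶠ s in 𝓝[puncturedPolydisc r] 0, ∀ j,
    |(z s j).re| ≤ C * (1 + |Real.log ‖s j‖|) ^ k

end HodgeLimit

end

open HodgeLimit

/-!
The point is that `Γ(s)` commutes with `N_j` along the divisor `s_j = 0`. Differentiating the local
normal form in `z_j` and letting `s_j → 0`, horizontality of the period map says that
`Ad(e^{-Γ(s)}) N_j` lowers `F_∞` by one step where `s_j = 0`, and at `s = 0` that so does `N_j`.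
Being real and lowering `M` by two steps, `N_j` then also lowers by one step the filtration
`⨁_{a ≤ p} I^{a,b}` opposite to `F_∞`. Since `Γ(s) ∈ 𝔮` lowers that filtration too, the difference
`Ad(e^{-Γ(s)}) N_j - N_j` lowers it by two steps and `F_∞` by only one; as the filtrations are
opposite, the difference vanishes. So the unipotent operator `Ad(e^{-Γ(s)})` fixes `N_j`, which
forces its nilpotent logarithm `-ad Γ(s)` to kill `N_j`.

For the limit, expand `Γ` along one variable at a time: the restriction to `s_j = 0` is fixed by
`Ad(e^{z_j N_j})`, and what remains is `O(|s_j|)`, while `Ad(e^{z_j N_j})` has norm bounded by a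
polynomial in `|z_j|`, hence in `log |s_j|`.
-/

namespace HodgeLimit

open NormedSpace (exp)

section Exponential

variable {A : Type*} [NormedRing A] [NormedAlgebra ℂ A] {a : A}

theorem exp_eq_sum_of_pow_eq_zero {m : ℕ} (h : a ^ m = 0) :
    exp a = ∑ n ∈ Finset.range m, (n.factorial : ℂ)⁻¹ • a ^ n := by
  rw [NormedSpace.exp_eq_tsum ℂ]
  refine tsum_eq_sum fun n hn => ?_
  rw [pow_eq_zero_of_le (by simpa using hn) h, smul_zero]

theorem exists_isUnit_exp_eq_one_add_mul (ha : IsNilpotent a) :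
    ∃ u, IsUnit u ∧ exp a = 1 + u * a := by
  obtain ⟨m, hm⟩ := ha
  let q : A := ∑ n ∈ Finset.range m, ((n + 2).factorial : ℂ)⁻¹ • a ^ n
  have hq : Commute q a :=
    Commute.sum_left _ _ _ fun n _ => ((Commute.refl a).pow_left n).smul_left _
  refine ⟨1 + q * a, (hq.isNilpotent_mul_left ⟨m, hm⟩).isUnit_one_add, ?_⟩
  rw [exp_eq_sum_of_pow_eq_zero (pow_eq_zero_of_le (by lia : m ≤ m + 2) hm),
    Finset.sum_range_succ', Finset.sum_range_succ']
  have hsum : q * a * a = ∑ n ∈ Finset.range m, ((n + 2).factorial : ℂ)⁻¹ • a ^ (n + 2) := by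
    simp only [q, Finset.sum_mul, smul_mul_assoc, ← pow_succ]
  simp [add_mul, hsum, add_comm, add_left_comm]

theorem exists_norm_exp_smul_le (ha : IsNilpotent a) :
    ∃ (C : ℝ) (m : ℕ), ∀ t : ℂ, ‖exp (t • a)‖ ≤ C * (1 + ‖t‖) ^ m := by
  obtain ⟨m, hm⟩ := ha
  refine ⟨∑ n ∈ Finset.range m, ‖(n.factorial : ℂ)⁻¹‖ * ‖a ^ n‖, m, fun t => ?_⟩
  have hpow : ∀ n ∈ Finset.range m, ‖t‖ ^ n ≤ (1 + ‖t‖) ^ m := fun n hn =>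
    (pow_le_pow_left₀ (norm_nonneg t) (by linarith) n).trans
      (pow_le_pow_right₀ (by linarith [norm_nonneg t]) (Finset.mem_range.1 hn).le)
  rw [exp_eq_sum_of_pow_eq_zero (a := t • a) (m := m) (by rw [smul_pow, hm, smul_zero]),
    Finset.sum_mul]
  refine norm_sum_le_of_le _ fun n hn => ?_
  calc ‖(n.factorial : ℂ)⁻¹ • (t • a) ^ n‖
      = ‖(n.factorial : ℂ)⁻¹‖ * ‖a ^ n‖ * ‖t‖ ^ n := by
        rw [smul_pow, norm_smul, norm_smul, norm_pow]; ring
    _ ≤ ‖(n.factorial : ℂ)⁻¹‖ * ‖a ^ n‖ * (1 + ‖t‖) ^ m := by gcongr; exact hpow n hn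

theorem tendsto_norm_exp_smul_mul {α : Type*} {l : Filter α} (ha : IsNilpotent a) {t : α → ℂ}
    {x : α → ℝ} (hx : ∀ i, 0 ≤ x i) (h : ∀ m, Tendsto (fun i => x i * (1 + ‖t i‖) ^ m) l (𝓝 0)) :
    Tendsto (fun i => ‖exp (t i • a)‖ * x i) l (𝓝 0) := by
  obtain ⟨C, m, hC⟩ := exists_norm_exp_smul_le ha
  refine squeeze_zero (fun i => mul_nonneg (norm_nonneg _) (hx i)) (fun i => ?_)
    (by simpa using (h m).const_mul C)
  calc ‖exp (t i • a)‖ * x i ≤ C * (1 + ‖t i‖) ^ m * x i :=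
        mul_le_mul_of_nonneg_right (hC _) (hx i)
    _ = C * (x i * (1 + ‖t i‖) ^ m) := by ring

variable [CompleteSpace A]

theorem exp_add_of_commute {b : A} (h : Commute a b) : exp (a + b) = exp a * exp b :=
  let _ := NormedAlgebra.restrictScalars ℚ ℂ A
  NormedSpace.exp_add_of_commute h

theorem exp_neg_mul_exp (a : A) : exp (-a) * exp a = 1 := by
  rw [← exp_add_of_commute (Commute.refl a).neg_left, neg_add_cancel, NormedSpace.exp_zero]

theorem differentiable_exp : Differentiable ℂ (exp : A → A) := fun a =>
  (NormedSpace.exp_analytic (𝕂 := ℂ) a).differentiableAt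

theorem map_exp_of_map_pow {B : Type*} [NormedRing B] [NormedAlgebra ℂ B] (φ : A →L[ℂ] B)
    (h : ∀ n, φ (a ^ n) = φ a ^ n) : φ (exp a) = exp (φ a) := by
  rw [NormedSpace.exp_eq_tsum ℂ (𝔸 := B)]
  refine ((φ.hasSum (NormedSpace.exp_series_hasSum_exp' (𝕂 := ℂ) a)).congr_fun ?_).tsum_eq.symm
  simp [h]

end Exponential

section ExponentialOperator

variable {V : Type*} [NormedAddCommGroup V] [NormedSpace ℂ V] {X Y : V →L[ℂ] V} {v : V}

theorem exp_apply_sub_self_mem {S : Submodule ℂ V} (hX : IsNilpotent X)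
    (h : ∀ n, (X ^ (n + 1)) v ∈ S) : exp X v - v ∈ S := by
  obtain ⟨m, hm⟩ := hX
  rw [exp_eq_sum_of_pow_eq_zero (pow_eq_zero_of_le m.le_succ hm), Finset.sum_range_succ']
  simpa using sum_mem fun n _ => S.smul_mem _ (h n)

theorem apply_eq_zero_of_exp_apply_eq_self (hX : IsNilpotent X) (h : exp X v = v) : X v = 0 := by
  obtain ⟨_, ⟨u, rfl⟩, hexp⟩ := exists_isUnit_exp_eq_one_add_mul hX
  have huX : (u : V →L[ℂ] V) (X v) = 0 := by simpa [hexp] using h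
  calc X v = (↑u⁻¹ * ↑u : V →L[ℂ] V) (X v) := by rw [u.inv_mul]; rfl
    _ = (↑u⁻¹ : V →L[ℂ] V) ((u : V →L[ℂ] V) (X v)) := rfl
    _ = 0 := by rw [huX, map_zero]

variable [CompleteSpace V]

theorem exp_apply_eq_self (h : X v = 0) : exp X v = v := by
  have hsum := (ContinuousLinearMap.apply ℂ V v).hasSum
    (NormedSpace.exp_series_hasSum_exp' (𝕂 := ℂ) X)
  refine hsum.unique (hasSum_single 0 fun n hn => ?_) |>.trans ?_
  · obtain ⟨k, rfl⟩ := Nat.exists_eq_succ_of_ne_zero hn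
    simp [pow_succ, h]
  · simp

theorem exp_neg_apply_exp_apply (X : V →L[ℂ] V) :
    Function.LeftInverse (exp (-X) : V →L[ℂ] V) (exp X : V →L[ℂ] V) := fun v => by
  rw [← mul_apply_eq_comp, exp_neg_mul_exp, one_apply_eq_self]

theorem exp_add_apply_eq (hXY : Commute X Y) {v₀ : V} (h : X v₀ = 0) (v : V) :
    exp (X + Y) v = exp Y v₀ + exp X (exp Y (v - v₀)) := by
  have hv₀ : exp (Y + X) v₀ = exp Y v₀ := by
    rw [exp_add_of_commute hXY.symm, mul_apply_eq_comp, exp_apply_eq_self h]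
  calc exp (X + Y) v = exp (X + Y) v₀ + exp (X + Y) (v - v₀) := by rw [map_sub]; abel
    _ = exp Y v₀ + exp X (exp Y (v - v₀)) := by
      rw [add_comm X Y, hv₀, add_comm Y X, exp_add_of_commute hXY, mul_apply_eq_comp]

end ExponentialOperator

section ContinuousAd

variable {A : Type*} [NormedRing A] [NormedAlgebra ℂ A] {a b : A}

/-- The adjoint action `b ↦ a * b - b * a` of a normed algebra on itself, as a continuous linear
map. It turns `Ad (exp a)` into the exponential of a single operator. -/
noncomputable def continuousAd : A →L[ℂ] A →L[ℂ] A := .mul ℂ A - (ContinuousLinearMap.mul ℂ A).flip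

theorem continuousAd_apply (a b : A) : continuousAd a b = a * b - b * a := rfl

theorem continuousAd_apply_eq_zero_iff : continuousAd a b = 0 ↔ Commute a b := sub_eq_zero

theorem commute_mul_mul_flip (a b : A) :
    Commute (ContinuousLinearMap.mul ℂ A a) ((ContinuousLinearMap.mul ℂ A).flip b) := by
  ext c
  simp [mul_assoc]

theorem commute_continuousAd (h : Commute a b) : Commute (continuousAd a) (continuousAd b) := by
  ext c
  simp only [mul_apply_eq_comp, continuousAd_apply]
  linear_combination (norm := noncomm_ring) h.eq * c - c * h.eq

theorem mul_apply_pow (a : A) (n : ℕ) :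
    ContinuousLinearMap.mul ℂ A (a ^ n) = ContinuousLinearMap.mul ℂ A a ^ n := by
  induction n with
  | zero => ext; simp
  | succ n ih => ext c; simp [pow_succ, ← ih, mul_assoc]

theorem mul_flip_apply_pow (a : A) (n : ℕ) : (ContinuousLinearMap.mul ℂ A).flip (a ^ n)
    = (ContinuousLinearMap.mul ℂ A).flip a ^ n := by
  induction n with
  | zero => ext; simp
  | succ n ih => ext c; rw [pow_succ, pow_succ', mul_apply_eq_comp, ← ih]; simp [mul_assoc]

theorem isNilpotent_continuousAd (ha : IsNilpotent a) : IsNilpotent (continuousAd a) := by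
  obtain ⟨m, hm⟩ := ha
  exact (commute_mul_mul_flip a a).isNilpotent_sub ⟨m, by rw [← mul_apply_pow, hm, map_zero]⟩
    ⟨m, by rw [← mul_flip_apply_pow, hm, map_zero]⟩

theorem exp_continuousAd_apply [CompleteSpace A] (a b : A) :
    exp (continuousAd a) b = exp a * b * exp (-a) := by
  have hsplit : continuousAd a
      = .mul ℂ A a + (ContinuousLinearMap.mul ℂ A).flip (-a) := by
    rw [map_neg, ← sub_eq_add_neg]; rfl
  rw [hsplit, exp_add_of_commute (commute_mul_mul_flip a (-a)),
    ← map_exp_of_map_pow _ (mul_apply_pow a), ← map_exp_of_map_pow _ (mul_flip_apply_pow (-a))]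
  simp [mul_assoc]

theorem commute_of_exp_mul_mul_exp_neg_eq [CompleteSpace A] (ha : IsNilpotent a)
    (h : exp a * b * exp (-a) = b) : Commute a b :=
  continuousAd_apply_eq_zero_iff.1 <| apply_eq_zero_of_exp_apply_eq_self
    (isNilpotent_continuousAd ha) ((exp_continuousAd_apply a b).trans h)

end ContinuousAd

theorem isBoundedUnder_norm_fderiv {V W : Type*} [NormedAddCommGroup V] [NormedSpace ℂ V]
    [NormedAddCommGroup W] [NormedSpace ℂ W] {f : V → W} {U : Set V} (hU : IsOpen U)
    (hf : DifferentiableOn ℂ f U) {x : V} (hx : x ∈ U) :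
    (𝓝 x).IsBoundedUnder (· ≤ ·) fun y => ‖fderiv ℂ f y‖ := by
  have hcont : ContinuousAt f x := (hf.differentiableAt (hU.mem_nhds hx)).continuousAt
  obtain ⟨δ, hδ, hball⟩ := Metric.mem_nhds_iff.1
    (inter_mem (hU.mem_nhds hx) (hcont (Metric.ball_mem_nhds (f x) one_pos)))
  refine isBoundedUnder_of_eventually_le (a := 2 / (δ / 2)) ?_
  filter_upwards [Metric.ball_mem_nhds x (half_pos hδ)] with y hy
  have hsub : Metric.ball y (δ / 2) ⊆ Metric.ball x δ :=
    Metric.ball_subset_ball' (by linarith [Metric.mem_ball.1 hy])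
  have hy' := hball (hsub (Metric.mem_ball_self (half_pos hδ)))
  refine Complex.norm_fderiv_le_div_of_mapsTo_ball
    (hf.mono (hsub.trans (hball.trans Set.inter_subset_left))) (fun w hw => ?_) (half_pos hδ)
  calc dist (f w) (f y) ≤ dist (f w) (f x) + dist (f y) (f x) := dist_triangle_right _ _ _
    _ ≤ 2 := by linarith [Metric.mem_ball.1 (hball (hsub hw)).2, Metric.mem_ball.1 hy'.2]

section Polydisc

variable {V : Type*} [NormedAddCommGroup V] [NormedSpace ℂ V] {r : ℕ} {ρ B : ℝ}
  {f : (Fin r → ℂ) → V} {s : Fin r → ℂ}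

theorem isOpen_polydisc : IsOpen (polydisc r ρ) := by
  simp only [polydisc, Set.ofPred_forall]
  exact isOpen_iInter_of_finite fun j => isOpen_lt (by fun_prop) continuous_const

theorem zero_mem_polydisc (hρ : 0 < ρ) : (0 : Fin r → ℂ) ∈ polydisc r ρ := fun _ => by
  simpa using hρ

theorem polydisc_mem_nhds (hρ : 0 < ρ) : polydisc r ρ ∈ 𝓝 (0 : Fin r → ℂ) :=
  isOpen_polydisc.mem_nhds (zero_mem_polydisc hρ)

theorem polydisc_mono : Monotone (polydisc r) := fun _ _ h _ hs j => (hs j).trans_le h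

theorem polydisc_eq_ball (hρ : 0 < ρ) : polydisc r ρ = Metric.ball 0 ρ := by
  ext s
  simp [polydisc, pi_norm_lt_iff hρ]

theorem update_mem_polydisc (hs : s ∈ polydisc r ρ) (i : Fin r) {t : ℂ} (ht : ‖t‖ < ρ) :
    Function.update s i t ∈ polydisc r ρ := by
  intro j
  rcases eq_or_ne j i with rfl | h
  · simpa using ht
  · simpa [h] using hs j

theorem differentiableOn_comp_update_const (hf : DifferentiableOn ℂ f (polydisc r ρ)) (i : Fin r)
    {t : ℂ} (ht : ‖t‖ < ρ) :
    DifferentiableOn ℂ (fun s => f (Function.update s i t)) (polydisc r ρ) := by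
  have hupdate : Differentiable ℂ fun s : Fin r → ℂ => Function.update s i t := by
    refine differentiable_pi.2 fun j => ?_
    rcases eq_or_ne j i with rfl | h
    · simp
    · simp only [ne_eq, h, not_false_eq_true, Function.update_of_ne]
      fun_prop
  exact hf.comp hupdate.differentiableOn fun s hs => update_mem_polydisc hs i ht

theorem norm_update_sub_update_zero_le (hf : DifferentiableOn ℂ f (polydisc r ρ))
    (hB : ∀ s ∈ polydisc r ρ, ‖f s‖ ≤ B) (hs : s ∈ polydisc r ρ) (i : Fin r) {t : ℂ}
    (ht : ‖t‖ < ρ) :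
    ‖f (Function.update s i t) - f (Function.update s i 0)‖ ≤ 2 * B / ρ * ‖t‖ := by
  have hρ : 0 < ρ := (norm_nonneg t).trans_lt ht
  have hslice : DifferentiableOn ℂ (fun t => f (Function.update s i t)) (Metric.ball 0 ρ) :=
    hf.comp (fun t _ => (hasFDerivAt_update s t).differentiableAt.differentiableWithinAt)
      fun t ht => update_mem_polydisc hs i (by simpa using ht)
  have hmaps : Set.MapsTo (fun t => f (Function.update s i t)) (Metric.ball 0 ρ)
      (Metric.closedBall (f (Function.update s i 0)) (2 * B)) := fun w hw => by
    rw [Metric.mem_closedBall, dist_eq_norm, two_mul]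
    exact norm_sub_le_of_le (hB _ (update_mem_polydisc hs i (by simpa using hw)))
      (hB _ (update_mem_polydisc hs i (by simpa using hρ)))
  simpa [dist_eq_norm] using
    Complex.dist_le_div_mul_dist_of_mapsTo_ball hslice hmaps (by simpa using ht)

variable [CompleteSpace V] {X : Fin r → V →L[ℂ] V}

theorem norm_exp_sum_apply_le (hX : ∀ i j, Commute (X i) (X j)) (K : Finset (Fin r))
    (hf : DifferentiableOn ℂ f (polydisc r ρ)) (hB : ∀ s ∈ polydisc r ρ, ‖f s‖ ≤ B)
    (hker : ∀ j ∈ K, ∀ s ∈ polydisc r ρ, s j = 0 → X j (f s) = 0) (hs : s ∈ polydisc r ρ) :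
    ‖exp (∑ j ∈ K, X j) (f s)‖ ≤ B * ∏ j ∈ K, (1 + 2 / ρ * (‖exp (X j)‖ * ‖s j‖)) := by
  induction K using Finset.induction_on generalizing f B with
  | empty => simpa using hB s hs
  | insert i K hi ih =>
    have hρ : ‖(0 : ℂ)‖ < ρ := by simpa using (norm_nonneg _).trans_lt (hs i)
    have hker' : ∀ t : ℂ, ‖t‖ < ρ → ∀ j ∈ K, ∀ s ∈ polydisc r ρ, s j = 0 →
        X j (f (Function.update s i t)) = 0 := fun t ht j hj s hs hsj => by
      refine hker j (Finset.mem_insert_of_mem hj) _ (update_mem_polydisc hs i ht) ?_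
      rw [Function.update_of_ne (ne_of_mem_of_not_mem hj hi), hsj]
    have hrestrict := ih (differentiableOn_comp_update_const hf i hρ)
      (fun s hs => hB _ (update_mem_polydisc hs i hρ)) (hker' 0 hρ)
    have hdiff := ih (f := fun s' => f (Function.update s' i (s i)) - f (Function.update s' i 0))
      ((differentiableOn_comp_update_const hf i (hs i)).sub
        (differentiableOn_comp_update_const hf i hρ))
      (fun s' hs' => norm_update_sub_update_zero_le hf hB hs' i (hs i))
      (fun j hj s' hs' h => by
        rw [map_sub, hker' _ (hs i) j hj s' hs' h, hker' 0 hρ j hj s' hs' h, sub_zero])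
    rw [Function.update_eq_self] at hdiff
    have hXi : X i (f (Function.update s i 0)) = 0 :=
      hker i (Finset.mem_insert_self i K) _ (update_mem_polydisc hs i hρ) (Function.update_self ..)
    set P := ∏ j ∈ K, (1 + 2 / ρ * (‖exp (X j)‖ * ‖s j‖))
    rw [Finset.sum_insert hi, Finset.prod_insert hi,
      exp_add_apply_eq (Commute.sum_right _ _ _ fun j _ => hX i j) hXi]
    calc _ ≤ B * P + ‖exp (X i)‖ * (2 * B / ρ * ‖s i‖ * P) :=
          norm_add_le_of_le hrestrict (ContinuousLinearMap.le_opNorm_of_le _ hdiff)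
      _ = B * ((1 + 2 / ρ * (‖exp (X i)‖ * ‖s i‖)) * P) := by ring

theorem tendsto_exp_sum_smul_apply (hX : ∀ i j, Commute (X i) (X j))
    (hnil : ∀ j, IsNilpotent (X j)) (hρ : 0 < ρ) (hf : DifferentiableOn ℂ f (polydisc r ρ))
    (hf0 : f 0 = 0) (hker : ∀ j, ∀ s ∈ polydisc r ρ, s j = 0 → X j (f s) = 0)
    {l : Filter (Fin r → ℂ)} (hl : l ≤ 𝓝 0) {z : (Fin r → ℂ) → Fin r → ℂ}
    (hz : ∀ j m, Tendsto (fun s => ‖s j‖ * (1 + ‖z s j‖) ^ m) l (𝓝 0)) :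
    Tendsto (fun s => exp (∑ j, z s j • X j) (f s)) l (𝓝 0) := by
  rw [Metric.tendsto_nhds]
  intro ε hε
  have hcont : ContinuousAt f 0 := (hf.differentiableAt (polydisc_mem_nhds hρ)).continuousAt
  obtain ⟨δ, hδ, hsmall⟩ := Metric.continuousAt_iff.1 hcont (ε / 2) (half_pos hε)
  set ρ' := min ρ δ
  have hρ' : 0 < ρ' := lt_min hρ hδ
  have hsub : polydisc r ρ' ⊆ polydisc r ρ := polydisc_mono (min_le_left _ _)
  have hB : ∀ s ∈ polydisc r ρ', ‖f s‖ ≤ ε / 2 := fun s hs => by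
    have hsδ : s ∈ polydisc r δ := polydisc_mono (min_le_right _ _) hs
    rw [polydisc_eq_ball hδ] at hsδ
    simpa [hf0] using (hsmall hsδ).le
  have hprod : Tendsto (fun s => ∏ j, (1 + 2 / ρ' * (‖exp (z s j • X j)‖ * ‖s j‖))) l (𝓝 1) := by
    simpa using tendsto_finsetProd Finset.univ fun j _ => ((tendsto_norm_exp_smul_mul (hnil j)
      (fun s : Fin r → ℂ => norm_nonneg (s j)) (hz j)).const_mul (2 / ρ')).const_add 1
  filter_upwards [hprod.eventually (gt_mem_nhds one_lt_two), hl (polydisc_mem_nhds hρ')]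
    with s hs2 hsρ'
  rw [dist_zero_right]
  have hle := norm_exp_sum_apply_le (X := fun j => z s j • X j)
    (fun i j => ((hX i j).smul_left _).smul_right _) Finset.univ (hf.mono hsub) hB
    (fun j _ s' hs' hj => by rw [smul_apply, hker j s' (hsub hs') hj, smul_zero]) hsρ'
  nlinarith

end Polydisc

section BranchChoice

variable {r : ℕ}

theorem tendsto_mul_one_add_abs_log_pow_nhdsGT_zero (n : ℕ) :
    Tendsto (fun x : ℝ => x * (1 + |Real.log x|) ^ n) (𝓝[>] 0) (𝓝 0) := by
  have hinv : Tendsto (fun x : ℝ => Real.exp 1 * x⁻¹) (𝓝[>] 0) atTop :=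
    tendsto_inv_nhdsGT_zero.const_mul_atTop (Real.exp_pos 1)
  refine ((Real.tendsto_pow_log_div_mul_add_atTop (Real.exp (-1)) 0 n
    (Real.exp_pos _).ne').comp hinv).congr' ?_
  filter_upwards [Ioo_mem_nhdsGT one_pos] with x hx
  rw [Function.comp_apply, Real.log_mul (Real.exp_pos 1).ne' (inv_ne_zero hx.1.ne'), Real.log_exp,
    Real.log_inv, abs_of_nonpos (Real.log_nonpos hx.1.le hx.2.le), ← mul_assoc, ← Real.exp_add]
  simp [mul_comm]

theorem norm_cover (z : Fin r → ℂ) (j : Fin r) :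
    ‖cover z j‖ = Real.exp (-(2 * Real.pi * (z j).im)) := by
  rw [cover, Complex.norm_exp]
  congr 1
  simp [mul_assoc]

theorem abs_im_le_abs_log_norm_cover (z : Fin r → ℂ) (j : Fin r) :
    |(z j).im| ≤ |Real.log ‖cover z j‖| := by
  rw [norm_cover, Real.log_exp, abs_neg, abs_mul, abs_of_pos Real.two_pi_pos]
  exact le_mul_of_one_le_left (abs_nonneg _) (by linarith [Real.pi_gt_three])

theorem IsBranchChoice.exists_one_add_norm_le {z : (Fin r → ℂ) → Fin r → ℂ}
    (hz : IsBranchChoice z) : ∃ (C : ℝ) (k : ℕ), ∀ᶠ s in 𝓝[puncturedPolydisc r] 0, ∀ j,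
      1 + ‖z s j‖ ≤ C * (1 + |Real.log ‖s j‖|) ^ k := by
  obtain ⟨hcover, C, k, hre⟩ := hz
  refine ⟨1 + |C|, k + 1, ?_⟩
  filter_upwards [hcover, hre] with s hs hre j
  have him : |(z s j).im| ≤ |Real.log ‖s j‖| := by
    simpa only [hs] using abs_im_le_abs_log_norm_cover (z s) j
  set L := |Real.log ‖s j‖|
  have hL : 1 ≤ 1 + L := le_add_of_nonneg_right (abs_nonneg _)
  calc 1 + ‖z s j‖ ≤ 1 + (|(z s j).re| + |(z s j).im|) := by
        gcongr; exact Complex.norm_le_abs_re_add_abs_im _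
    _ ≤ (1 + L) + |C| * (1 + L) ^ k := by
        have hC : C * (1 + L) ^ k ≤ |C| * (1 + L) ^ k :=
          mul_le_mul_of_nonneg_right (le_abs_self C) (by positivity)
        linarith [hre j]
    _ ≤ (1 + L) ^ (k + 1) + |C| * (1 + L) ^ (k + 1) := by
        gcongr
        · exact le_self_pow₀ hL k.succ_ne_zero
        · exact k.le_succ
    _ = (1 + |C|) * (1 + L) ^ (k + 1) := by ring

theorem IsBranchChoice.tendsto_mul_pow {z : (Fin r → ℂ) → Fin r → ℂ} (hz : IsBranchChoice z)
    (j : Fin r) (m : ℕ) :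
    Tendsto (fun s => ‖s j‖ * (1 + ‖z s j‖) ^ m) (𝓝[puncturedPolydisc r] 0) (𝓝 0) := by
  obtain ⟨C, k, hC⟩ := hz.exists_one_add_norm_le
  have hnorm : Tendsto (fun s : Fin r → ℂ => ‖s j‖) (𝓝[puncturedPolydisc r] 0) (𝓝[>] 0) := by
    refine tendsto_nhdsWithin_iff.2 ⟨?_, ?_⟩
    · have hcont : Continuous fun s : Fin r → ℂ => ‖s j‖ := by fun_prop
      simpa using (hcont.tendsto 0).mono_left nhdsWithin_le_nhds
    · filter_upwards [self_mem_nhdsWithin] with s hs using norm_pos_iff.2 (hs j).1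
  have hlim := ((tendsto_mul_one_add_abs_log_pow_nhdsGT_zero (k * m)).comp hnorm).const_mul (C ^ m)
  rw [mul_zero] at hlim
  refine squeeze_zero' (Eventually.of_forall fun s => by positivity) ?_ hlim
  filter_upwards [hC] with s hs
  calc ‖s j‖ * (1 + ‖z s j‖) ^ m ≤ ‖s j‖ * (C * (1 + |Real.log ‖s j‖|) ^ k) ^ m := by
        gcongr; exact hs j
    _ = C ^ m * (‖s j‖ * (1 + |Real.log ‖s j‖|) ^ (k * m)) := by ring

end BranchChoice

section Lowering

variable {E : Type*} [NormedAddCommGroup E] [NormedSpace ℂ E] {L : ℤ → Submodule ℂ E}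
  {X T : E →L[ℂ] E} {k l : ℤ}

/-- The endomorphisms which lower the index of a filtration `L` by `k`. The index of a decreasing
filtration may be lowered as well: horizontality is `lowering F 1`. -/
def lowering (L : ℤ → Submodule ℂ E) (k : ℤ) : Submodule ℂ (E →L[ℂ] E) where
  carrier := {T | ∀ p, ∀ v ∈ L p, T v ∈ L (p - k)}
  zero_mem' := fun _ _ _ => zero_mem _
  add_mem' := fun hS hT p v hv => add_mem (hS p v hv) (hT p v hv)
  smul_mem' := fun c _ hT p v hv => Submodule.smul_mem _ c (hT p v hv)

theorem lowering_antitone (hL : Monotone L) : Antitone (lowering L) := fun _ _ hkl _ hT p v hv =>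
  hL (by lia) (hT p v hv)

theorem mul_mem_lowering (hX : X ∈ lowering L k) (hT : T ∈ lowering L l) :
    X * T ∈ lowering L (k + l) := fun p v hv => by
  have hXT := hX _ _ (hT p v hv)
  rwa [sub_sub, add_comm l k] at hXT

theorem pow_mem_lowering (hX : X ∈ lowering L k) (n : ℕ) : X ^ n ∈ lowering L (n * k) := by
  induction n with
  | zero => intro p v hv; simpa using hv
  | succ n ih => simpa only [pow_succ, Nat.cast_succ, add_one_mul] using mul_mem_lowering ih hX

theorem isNilpotent_of_mem_lowering (hL : Monotone L) (htop : ∃ p, L p = ⊤) (hbot : ∃ p, L p = ⊥)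
    (hX : X ∈ lowering L 1) : IsNilpotent X := by
  obtain ⟨p, hp⟩ := htop
  obtain ⟨q, hq⟩ := hbot
  refine ⟨(p - q).toNat, ContinuousLinearMap.ext fun v => ?_⟩
  have hv := pow_mem_lowering hX (p - q).toNat p v (hp ▸ Submodule.mem_top)
  have hle := hL (show p - (p - q).toNat * 1 ≤ q by lia) hv
  rwa [hq, Submodule.mem_bot] at hle

theorem continuousAd_apply_mem_lowering (hX : X ∈ lowering L k) (hT : T ∈ lowering L l) :
    continuousAd X T ∈ lowering L (k + l) :=
  sub_mem (mul_mem_lowering hX hT) (add_comm k l ▸ mul_mem_lowering hT hX)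

theorem adExp_sub_self_mem_lowering [CompleteSpace E] (hL : Monotone L)
    (hX : X ∈ lowering L 1) (hnil : IsNilpotent X) (hT : T ∈ lowering L k) :
    adExp X T - T ∈ lowering L (k + 1) := by
  have hpow : ∀ n, (continuousAd X ^ (n + 1)) T ∈ lowering L (k + 1) := fun n => by
    induction n with
    | zero => simpa [add_comm] using continuousAd_apply_mem_lowering hX hT
    | succ n ih =>
      rw [pow_succ', mul_apply_eq_comp]
      exact lowering_antitone hL (le_add_of_nonneg_left zero_le_one)
        (continuousAd_apply_mem_lowering hX ih)
  rw [adExp, ← exp_continuousAd_apply]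
  exact exp_apply_sub_self_mem (isNilpotent_continuousAd hnil) hpow

theorem isClosed_lowering [FiniteDimensional ℂ E] (L : ℤ → Submodule ℂ E) (k : ℤ) :
    IsClosed (lowering L k : Set (E →L[ℂ] E)) :=
  (lowering L k).closed_of_finiteDimensional

end Lowering

section PieceSum

variable {R E : Type*} [Ring R] [AddCommGroup E] [Module R E] {I : ℤ → ℤ → Submodule R E}
  {S T : Set (ℤ × ℤ)}

theorem biSup_inf_biSup {ι : Type*} {J : ι → Submodule R E} (h : iSupIndep J) (S T : Set ι) :
    (⨆ i ∈ S, J i) ⊓ (⨆ i ∈ T, J i) = ⨆ i ∈ S ∩ T, J i := by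
  have hle : (⨆ i ∈ S ∩ T, J i) ≤ ⨆ i ∈ T, J i := biSup_mono fun _ hi => hi.2
  have hdisj : Disjoint (⨆ i ∈ S \ T, J i) (⨆ i ∈ T, J i) :=
    h.disjoint_biSup_biSup Set.disjoint_sdiff_left
  calc (⨆ i ∈ S, J i) ⊓ (⨆ i ∈ T, J i)
      = ((⨆ i ∈ S ∩ T, J i) ⊔ ⨆ i ∈ S \ T, J i) ⊓ (⨆ i ∈ T, J i) := by
        rw [← iSup_union, Set.inter_union_sdiff]
    _ = ⨆ i ∈ S ∩ T, J i := by rw [sup_inf_assoc_of_le _ hle, hdisj.eq_bot, sup_bot_eq]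

/-- The sum of the pieces `I a b` of a bigrading with `(a, b) ∈ S`; the Hodge filtration, the
weight filtration and their conjugates are all of this form. -/
def pieceSum (I : ℤ → ℤ → Submodule R E) (S : Set (ℤ × ℤ)) : Submodule R E :=
  ⨆ i ∈ S, I i.1 i.2

theorem pieceSum_le {A : Submodule R E} : pieceSum I S ≤ A ↔ ∀ a b, (a, b) ∈ S → I a b ≤ A := by
  simp only [pieceSum, iSup_le_iff, Prod.forall]

theorem le_pieceSum {a b : ℤ} (h : (a, b) ∈ S) : I a b ≤ pieceSum I S :=
  pieceSum_le.1 le_rfl a b h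

theorem pieceSum_mono (h : S ⊆ T) : pieceSum I S ≤ pieceSum I T :=
  biSup_mono h

theorem pieceSum_inf (h : iSupIndep fun i : ℤ × ℤ => I i.1 i.2) (S T : Set (ℤ × ℤ)) :
    pieceSum I S ⊓ pieceSum I T = pieceSum I (S ∩ T) :=
  biSup_inf_biSup h S T

theorem iSup_eq_pieceSum (I : ℤ → ℤ → Submodule R E) (P : ℤ → ℤ → Prop) :
    (⨆ (a : ℤ) (b : ℤ) (_ : P a b), I a b) = pieceSum I {i | P i.1 i.2} := by
  simp only [pieceSum, Set.mem_ofPred_eq, iSup_prod]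

/-- The increasing filtration opposite to the decreasing filtration by the first index of a
bigrading. -/
def opposite (I : ℤ → ℤ → Submodule R E) (p : ℤ) : Submodule R E := pieceSum I {i | i.1 ≤ p}

theorem opposite_mono : Monotone (opposite I) := fun _ _ h => pieceSum_mono fun _ hi => hi.trans h

theorem exists_opposite_eq_bot [IsNoetherian R E] (h : iSupIndep fun i : ℤ × ℤ => I i.1 i.2) :
    ∃ p, opposite I p = ⊥ := by
  obtain ⟨p, hp⟩ := ((WellFoundedGT.finite_ne_bot_of_iSupIndep h).image Prod.fst).bddBelow
  refine ⟨p - 1, eq_bot_iff.2 (pieceSum_le.2 fun a b hab => ?_)⟩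
  by_contra hne
  have hpa : p ≤ a := hp ⟨(a, b), fun h0 => hne h0.le, rfl⟩
  exact absurd hab (by simpa using hpa)

theorem exists_opposite_eq_top [IsNoetherian R E]
    (h : DirectSum.IsInternal fun i : ℤ × ℤ => I i.1 i.2) : ∃ p, opposite I p = ⊤ := by
  obtain ⟨p, hp⟩ := ((WellFoundedGT.finite_ne_bot_of_iSupIndep
    h.submodule_iSupIndep).image Prod.fst).bddAbove
  refine ⟨p, eq_top_iff.2 (h.submodule_iSup_eq_top.ge.trans (iSup_le fun i => ?_))⟩
  by_cases hi : I i.1 i.2 = ⊥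
  · simp [hi]
  · exact le_pieceSum (hp ⟨i, hi, rfl⟩)

end PieceSum

section Bigrading

variable {E : Type*} [NormedAddCommGroup E] [NormedSpace ℂ E] {D : PolarizedData E}
  {F M : ℤ → Submodule ℂ E} {I : ℤ → ℤ → Submodule ℂ E} {N X T : E →L[ℂ] E}

theorem gPiece_le_lowering_opposite (a b : ℤ) :
    gPiece D I a b ≤ lowering (opposite I) (-a) := fun X hX p => by
  have hle : opposite I p ≤ (opposite I (p - -a)).comap (X : E →ₗ[ℂ] E) :=
    pieceSum_le.2 fun c d hcd u hu => le_pieceSum (by simpa using hcd) (hX.2 c d u hu)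
  exact hle

theorem qSub_le_lowering_opposite : qSub D I ≤ lowering (opposite I) 1 :=
  iSup_le fun a => iSup_le fun b => iSup_le fun ha => (gPiece_le_lowering_opposite a b).trans
    (lowering_antitone opposite_mono (by lia))

namespace IsDeligneBigrading

theorem hodge_eq_pieceSum (hI : IsDeligneBigrading D F M I) (p : ℤ) :
    F p = pieceSum I {i | p ≤ i.1} := by
  rw [hI.hodge, iSup_eq_pieceSum]

theorem weight_eq_pieceSum (hI : IsDeligneBigrading D F M I) (k : ℤ) :
    M k = pieceSum I {i | i.1 + i.2 ≤ k} := by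
  rw [hI.weight, iSup_eq_pieceSum]

theorem piece_le_hodge (hI : IsDeligneBigrading D F M I) (a b : ℤ) : I a b ≤ F a := by
  rw [hI.hodge_eq_pieceSum]
  exact le_pieceSum (le_refl a)

theorem piece_le_weight (hI : IsDeligneBigrading D F M I) (a b : ℤ) : I a b ≤ M (a + b) := by
  rw [hI.weight_eq_pieceSum]
  exact le_pieceSum (le_refl (a + b))

theorem hodge_inf_opposite (hI : IsDeligneBigrading D F M I) {p q : ℤ} (h : q < p) :
    F p ⊓ opposite I q = ⊥ := by
  rw [hI.hodge_eq_pieceSum, opposite, pieceSum_inf hI.internal.submodule_iSupIndep, eq_bot_iff,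
    pieceSum_le]
  rintro a b ⟨hpa, haq⟩
  exact absurd (h.trans_le hpa) haq.not_gt

theorem eq_zero_of_mem_lowering (hI : IsDeligneBigrading D F M I) (hF : T ∈ lowering F 1)
    (hopp : T ∈ lowering (opposite I) 2) : T = 0 := by
  have hker : (⨆ i : ℤ × ℤ, I i.1 i.2) ≤ LinearMap.ker (T : E →ₗ[ℂ] E) :=
    iSup_le fun ⟨a, b⟩ v hv => by
      have hTv : T v ∈ F (a - 1) ⊓ opposite I (a - 2) :=
        ⟨hF a v (hI.piece_le_hodge a b hv), hopp a v (le_pieceSum (le_refl a) hv)⟩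
      rwa [hI.hodge_inf_opposite (by lia), Submodule.mem_bot] at hTv
  rw [hI.internal.submodule_iSup_eq_top] at hker
  exact ContinuousLinearMap.ext fun v => hker Submodule.mem_top

theorem conj_mem_pieceSum (hI : IsDeligneBigrading D F M I) {S T : Set (ℤ × ℤ)}
    (hT : IsLowerSet T) (hST : Set.MapsTo Prod.swap S T) {v : E} (hv : v ∈ pieceSum I S) :
    D.conj v ∈ pieceSum I T := by
  have hle : pieceSum I S ≤ D.conjSub (pieceSum I T) := pieceSum_le.2 fun a b hab w hw => by
    have hconj : D.conj w ∈ D.conjSub (I a b) := by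
      simpa [PolarizedData.conjSub, D.conj_conj] using hw
    have hsup := (hI.conj b a).ge (Submodule.mem_sup_left hconj)
    rw [iSup_eq_pieceSum I fun c d => c < b ∧ d < a] at hsup
    refine (sup_le (le_pieceSum (hST hab)) (pieceSum_mono fun i hi => ?_) :
      I b a ⊔ pieceSum I _ ≤ pieceSum I T) hsup
    exact hT (show i ≤ (b, a) from ⟨hi.1.le, hi.2.le⟩) (hST hab)
  exact hle hv

theorem mem_lowering_pieceSum_snd (hI : IsDeligneBigrading D F M I) (hNF : N ∈ lowering F 1)
    (hNM : N ∈ lowering M 2) : N ∈ lowering (fun q => pieceSum I {i | i.2 ≤ q}) 1 := fun q => by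
  have hle : pieceSum I {i | i.2 ≤ q} ≤
      (pieceSum I {i | i.2 ≤ q - 1}).comap (N : E →ₗ[ℂ] E) := pieceSum_le.2 fun a b hab v hv => by
    have hmem : N v ∈ F (a - 1) ⊓ M (a + b - 2) :=
      ⟨hNF a v (hI.piece_le_hodge a b hv), hNM _ v (hI.piece_le_weight a b hv)⟩
    rw [hI.hodge_eq_pieceSum, hI.weight_eq_pieceSum,
      pieceSum_inf hI.internal.submodule_iSupIndep] at hmem
    refine pieceSum_mono (fun i hi => ?_) hmem
    simp only [Set.mem_inter_iff, Set.mem_ofPred_eq] at hab hi ⊢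
    lia
  exact hle

theorem mem_lowering_opposite (hI : IsDeligneBigrading D F M I)
    (hreal : ∀ v, N (D.conj v) = D.conj (N v)) (hNF : N ∈ lowering F 1)
    (hNM : N ∈ lowering M 2) : N ∈ lowering (opposite I) 1 := fun p v hv => by
  have hfst : IsLowerSet {i : ℤ × ℤ | i.1 ≤ p - 1} := fun i j hij hi => hij.1.trans hi
  have hsnd : IsLowerSet {i : ℤ × ℤ | i.2 ≤ p} := fun i j hij hi => hij.2.trans hi
  have hconj : D.conj v ∈ pieceSum I {i | i.2 ≤ p} := hI.conj_mem_pieceSum hsnd (fun _ hi => hi) hv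
  have hN := hI.conj_mem_pieceSum hfst (fun _ hi => hi)
    (hI.mem_lowering_pieceSum_snd hNF hNM p _ hconj)
  rwa [hreal, D.conj_conj] at hN

theorem commute_of_adExp_neg_mem_lowering [FiniteDimensional ℂ E]
    (hI : IsDeligneBigrading D F M I) (hNF : N ∈ lowering F 1)
    (hN : N ∈ lowering (opposite I) 1) (hX : X ∈ lowering (opposite I) 1)
    (hXN : adExp (-X) N ∈ lowering F 1) : Commute N X := by
  have := FiniteDimensional.complete ℂ E
  have hnil : IsNilpotent (-X) := (isNilpotent_of_mem_lowering opposite_mono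
    (exists_opposite_eq_top hI.internal)
    (exists_opposite_eq_bot hI.internal.submodule_iSupIndep) hX).neg
  have hF : adExp (-X) N - N ∈ lowering F 1 := sub_mem hXN hNF
  have hopp : adExp (-X) N - N ∈ lowering (opposite I) (1 + 1) :=
    adExp_sub_self_mem_lowering opposite_mono (neg_mem hX) hnil hN
  rw [one_add_one_eq_two] at hopp
  have hcomm : Commute (-X) N :=
    commute_of_exp_mul_mul_exp_neg_eq hnil (sub_eq_zero.1 (hI.eq_zero_of_mem_lowering hF hopp))
  exact (Commute.neg_left_iff.1 hcomm).symm

end IsDeligneBigrading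

end Bigrading

section Horizontality

variable {E : Type*} [NormedAddCommGroup E] [NormedSpace ℂ E] {r : ℕ} {N : Fin r → E →L[ℂ] E}
  {F : (Fin r → ℂ) → ℤ → Submodule ℂ E} {Φ : ℤ → Submodule ℂ E} {O : Set (Fin r → ℂ)}
  {G Γ : (Fin r → ℂ) → E →L[ℂ] E} {z s : Fin r → ℂ} {j : Fin r}

theorem isOpen_upperHalf : IsOpen (upperHalf r) := by
  simp only [upperHalf, Set.ofPred_forall]
  exact isOpen_iInter_of_finite fun j => isOpen_lt continuous_const (by fun_prop)

theorem differentiable_cover : Differentiable ℂ (cover : (Fin r → ℂ) → Fin r → ℂ) := by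
  unfold cover
  fun_prop

theorem exists_cover_eq (hs : s ∈ puncturedPolydisc r) : ∃ z ∈ upperHalf r, cover z = s := by
  have hcover : cover (fun j => Complex.log (s j) / (2 * Real.pi * Complex.I)) = s := by
    ext j
    rw [cover, mul_div_cancel₀ _ Complex.two_pi_I_ne_zero, Complex.exp_log (hs j).1]
  refine ⟨_, fun j => ?_, hcover⟩
  have hlt := (hs j).2
  rw [← hcover, norm_cover, Real.exp_lt_one_iff, neg_lt_zero] at hlt
  exact pos_of_mul_pos_right hlt Real.two_pi_pos.le

theorem hasLineDerivAt_cover (z : Fin r → ℂ) (j : Fin r) :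
    HasLineDerivAt ℂ cover ((2 * Real.pi * Complex.I * cover z j) • Pi.single j 1) z
      (Pi.single j 1) := by
  refine hasDerivAt_pi.2 fun i => ?_
  have hlin : HasDerivAt
      (fun t : ℂ => 2 * Real.pi * Complex.I * (z + t • (Pi.single j 1 : Fin r → ℂ)) i)
      (2 * Real.pi * Complex.I * (Pi.single j 1 : Fin r → ℂ) i) 0 := by
    simpa using ((((hasDerivAt_id (0 : ℂ)).mul_const ((Pi.single j 1 : Fin r → ℂ) i)).const_add
      (z i)).const_mul (2 * Real.pi * Complex.I))
  refine hlin.cexp.congr_deriv ?_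
  rcases eq_or_ne i j with rfl | h
  · simp [cover, mul_comm]
  · simp [h]

theorem monoSum_add_single (N : Fin r → E →L[ℂ] E) (z : Fin r → ℂ) (j : Fin r) (t : ℂ) :
    monoSum N (z + t • Pi.single j 1) = monoSum N z + t • N j := by
  simp [monoSum, add_smul, Finset.sum_add_distrib, Pi.single_apply]

theorem commute_monoSum (hN : ∀ i j, Commute (N i) (N j)) (z : Fin r → ℂ) (j : Fin r) :
    Commute (monoSum N z) (N j) :=
  Commute.sum_left _ _ _ fun i _ => (hN i j).smul_left _

variable [CompleteSpace E]

theorem hasLineDerivAt_exp_monoSum (hN : ∀ i j, Commute (N i) (N j)) (z : Fin r → ℂ)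
    (j : Fin r) : HasLineDerivAt ℂ (fun w => exp (monoSum N w)) (exp (monoSum N z) * N j) z
      (Pi.single j 1) := by
  have hexp : HasDerivAt (fun t : ℂ => exp (t • N j)) (N j) 0 := by
    simpa using hasDerivAt_exp_smul_const (N j) (0 : ℂ)
  refine (hexp.const_mul (exp (monoSum N z))).congr_of_eventuallyEq (.of_forall fun t => ?_)
  change exp (monoSum N _) = _
  rw [monoSum_add_single, exp_add_of_commute ((commute_monoSum hN z j).smul_right t)]

theorem hasLineDerivAt_exp_monoSum_mul_comp_cover (hN : ∀ i j, Commute (N i) (N j))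
    (hG : DifferentiableAt ℂ G (cover z)) (j : Fin r) :
    HasLineDerivAt ℂ (fun w => exp (monoSum N w) * G (cover w))
      (exp (monoSum N z) * (N j * G (cover z) +
        (2 * Real.pi * Complex.I * cover z j) • fderiv ℂ G (cover z) (Pi.single j 1))) z
      (Pi.single j 1) := by
  have hcover : HasDerivAt (fun t : ℂ => cover (z + t • Pi.single j 1)) _ 0 :=
    hasLineDerivAt_cover z j
  have hcomp : HasDerivAt (fun t : ℂ => G (cover (z + t • Pi.single j 1))) _ 0 :=
    HasFDerivAt.comp_hasDerivAt (0 : ℂ) (by simpa using hG.hasFDerivAt) hcover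
  refine (HasDerivAt.mul (hasLineDerivAt_exp_monoSum hN z j) hcomp).congr_deriv ?_
  simp [mul_add, mul_assoc]

theorem Horizontal.apply_mem_act (hF : Horizontal (upperHalf r) F)
    (hN : ∀ i j, Commute (N i) (N j)) (hO : IsOpen O) (hG : DifferentiableOn ℂ G O)
    (hFG : ∀ z ∈ upperHalf r, cover z ∈ O → ∀ p,
      F z p = act (exp (monoSum N z) * G (cover z)) (Φ p))
    (hs : s ∈ puncturedPolydisc r) (hsO : s ∈ O) (j : Fin r) {p : ℤ} {u : E} (hu : u ∈ Φ p) :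
    (N j * G s + (2 * Real.pi * Complex.I * s j) • fderiv ℂ G s (Pi.single j 1)) u ∈
      act (G s) (Φ (p - 1)) := by
  obtain ⟨z, hz, rfl⟩ := exists_cover_eq hs
  set v : (Fin r → ℂ) → E := fun w => (exp (monoSum N w) * G (cover w)) u
  have hO' : IsOpen (upperHalf r ∩ cover ⁻¹' O) :=
    isOpen_upperHalf.inter (hO.preimage differentiable_cover.continuous)
  have hmono : Differentiable ℂ (monoSum N) := by unfold monoSum; fun_prop
  have hvd : DifferentiableOn ℂ v (upperHalf r ∩ cover ⁻¹' O) :=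
    ((differentiable_exp.comp hmono).differentiableOn.mul
      (hG.comp differentiable_cover.differentiableOn fun w hw => hw.2)).clm_apply
      (differentiableOn_const u)
  have hderiv : fderiv ℂ v z (Pi.single j 1) = exp (monoSum N z) ((N j * G (cover z) +
      (2 * Real.pi * Complex.I * cover z j) • fderiv ℂ G (cover z) (Pi.single j 1)) u) := by
    have hline := hasLineDerivAt_exp_monoSum_mul_comp_cover hN
      (hG.differentiableAt (hO.mem_nhds hsO)) j
    have happly := HasDerivAt.clm_apply hline (hasDerivAt_const (0 : ℂ) u)
    have hfderiv := (hvd.differentiableAt (hO'.mem_nhds ⟨hz, hsO⟩)).hasFDerivAt.hasLineDerivAt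
      (Pi.single j 1)
    simpa using HasDerivAt.unique hfderiv happly
  have hmem := hF p _ hO' Set.inter_subset_left v hvd
    (fun w hw => hFG w hw.1 hw.2 p ▸ Submodule.mem_map_of_mem hu) z ⟨hz, hsO⟩ j
  rw [hderiv, hFG z hz hsO] at hmem
  obtain ⟨w, hw, heq⟩ := hmem
  exact ⟨w, hw, (exp_neg_apply_exp_apply (monoSum N z)).injective heq⟩

theorem Horizontal.exp_neg_mul_mem_lowering (hF : Horizontal (upperHalf r) F)
    (hN : ∀ i j, Commute (N i) (N j)) (hO : IsOpen O) (hΓ : DifferentiableOn ℂ Γ O)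
    (hFΓ : ∀ z ∈ upperHalf r, cover z ∈ O → ∀ p,
      F z p = act (exp (monoSum N z) * exp (Γ (cover z))) (Φ p))
    (hs : s ∈ puncturedPolydisc r) (hsO : s ∈ O) (j : Fin r) :
    exp (-Γ s) * (N j * exp (Γ s) + (2 * Real.pi * Complex.I * s j) •
      fderiv ℂ (fun s => exp (Γ s)) s (Pi.single j 1)) ∈ lowering Φ 1 := fun p u hu => by
  obtain ⟨w, hw, heq⟩ := hF.apply_mem_act (G := fun s => exp (Γ s)) hN hO
    (differentiable_exp.comp_differentiableOn hΓ) hFΓ hs hsO j hu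
  rw [mul_apply_eq_comp, ← heq]
  exact (exp_neg_apply_exp_apply (Γ s) w).symm ▸ hw

theorem Horizontal.adExp_neg_mem_lowering [FiniteDimensional ℂ E]
    (hF : Horizontal (upperHalf r) F) (hN : ∀ i j, Commute (N i) (N j)) (hO : IsOpen O)
    (hΓ : DifferentiableOn ℂ Γ O) (hFΓ : ∀ z ∈ upperHalf r, cover z ∈ O → ∀ p,
      F z p = act (exp (monoSum N z) * exp (Γ (cover z))) (Φ p))
    (hsO : s ∈ O) (hs : s ∈ polydisc r 1) (hsj : s j = 0) :
    adExp (-Γ s) (N j) ∈ lowering Φ 1 := by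
  have hexpΓ : DifferentiableOn ℂ (fun s => exp (Γ s)) O :=
    differentiable_exp.comp_differentiableOn hΓ
  have hcont : ContinuousAt Γ s := (hΓ.differentiableAt (hO.mem_nhds hsO)).continuousAt
  have hexp : Continuous (exp : (E →L[ℂ] E) → E →L[ℂ] E) := differentiable_exp.continuous
  have hcoeff : Tendsto (fun s : Fin r → ℂ => 2 * Real.pi * Complex.I * s j) (𝓝 s) (𝓝 0) := by
    have hcoord : Continuous fun s : Fin r → ℂ => 2 * Real.pi * Complex.I * s j := by fun_prop
    simpa [hsj] using hcoord.tendsto s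
  have hderiv := ((ContinuousLinearMap.apply ℂ (E →L[ℂ] E) (Pi.single j 1)).continuous.tendsto
    0).comp (hcoeff.zero_smul_isBoundedUnder_le (isBoundedUnder_norm_fderiv hO hexpΓ hsO))
  have hlim : Tendsto (fun s => exp (-Γ s) * (N j * exp (Γ s) + (2 * Real.pi * Complex.I * s j) •
      fderiv ℂ (fun s => exp (Γ s)) s (Pi.single j 1))) (𝓝 s) (𝓝 (adExp (-Γ s) (N j))) := by
    have hsum := (hexp.continuousAt.comp hcont.neg).tendsto.mul
      ((tendsto_const_nhds (x := N j)).mul (hexp.continuousAt.comp hcont).tendsto |>.add hderiv)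
    simpa [Function.comp_def, adExp, mul_assoc] using hsum
  have hdense : Dense {s : Fin r → ℂ | ∀ i, s i ≠ 0} := by
    simpa [Set.pi, Set.mem_compl_iff] using
      dense_pi Set.univ fun (_ : Fin r) _ => dense_compl_singleton (0 : ℂ)
  have := mem_closure_iff_nhdsWithin_neBot.1 (hdense s)
  refine (isClosed_lowering Φ 1).mem_of_tendsto
    (hlim.mono_left (nhdsWithin_le_nhds (s := {s | ∀ i, s i ≠ 0}))) ?_
  filter_upwards [self_mem_nhdsWithin, nhdsWithin_le_nhds (hO.mem_nhds hsO),
    nhdsWithin_le_nhds (isOpen_polydisc.mem_nhds hs)] with t ht htO ht1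
  exact hF.exp_neg_mul_mem_lowering hN hO hΓ hFΓ (fun i => ⟨ht i, ht1 i⟩) htO j

end Horizontality

theorem Variation.IsAdmissible.N_mem_lowering {E : Type*} [NormedAddCommGroup E] [NormedSpace ℂ E]
    {r : ℕ} {D : PolarizedData E} {𝒱 : Variation D r} {Finf M : ℤ → Submodule ℂ E}
    (h : 𝒱.IsAdmissible Finf M) (j : Fin r) : 𝒱.N j ∈ lowering M 2 := by
  have hone : monoSum 𝒱.N 1 ∈ lowering M 2 := by
    have hcast : (fun i => ((1 : Fin r → ℝ) i : ℂ)) = 1 := by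
      ext
      simp
    exact hcast ▸ (h.rel_cone 1 fun _ => one_pos).shift
  have hadd : monoSum 𝒱.N 1 + 𝒱.N j ∈ lowering M 2 := by
    have hpos : ∀ i, 0 < (1 + Pi.single j 1 : Fin r → ℝ) i := fun i =>
      add_pos_of_pos_of_nonneg one_pos
        ((Pi.single_nonneg.2 zero_le_one : (0 : Fin r → ℝ) ≤ Pi.single j 1) i)
    have hcast : (fun i => ((1 + Pi.single j 1 : Fin r → ℝ) i : ℂ))
        = 1 + (1 : ℂ) • Pi.single j 1 := by
      ext i
      simp [Pi.single_apply, apply_ite]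
    have hshift := (h.rel_cone _ hpos).shift
    rwa [hcast, monoSum_add_single, one_smul] at hshift
  simpa using sub_mem hadd hone

theorem Variation.IsLocalNormalForm.exists_commute {E : Type*} [NormedAddCommGroup E]
    [NormedSpace ℂ E] [FiniteDimensional ℂ E] {r : ℕ} {D : PolarizedData E} {𝒱 : Variation D r}
    {Finf M : ℤ → Submodule ℂ E} {I : ℤ → ℤ → Submodule ℂ E} {Γ : (Fin r → ℂ) → E →L[ℂ] E}
    (hΓ : 𝒱.IsLocalNormalForm Finf I Γ) (hI : IsDeligneBigrading D Finf M I)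
    (hM : ∀ j, 𝒱.N j ∈ lowering M 2) :
    ∃ ρ > 0, DifferentiableOn ℂ Γ (polydisc r ρ) ∧
      ∀ j, ∀ s ∈ polydisc r ρ, s j = 0 → Commute (𝒱.N j) (Γ s) := by
  have := FiniteDimensional.complete ℂ E
  obtain ⟨hΓ0, ρ, hρ, hd, hq, hFΓ⟩ := hΓ
  have hresidue : ∀ j, ∀ s ∈ polydisc r ρ, s ∈ polydisc r 1 → s j = 0 →
      adExp (-Γ s) (𝒱.N j) ∈ lowering Finf 1 := fun j s hs hs1 hsj =>
    𝒱.F_horiz.adExp_neg_mem_lowering 𝒱.N_comm isOpen_polydisc hd hFΓ hs hs1 hsj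
  have hNF : ∀ j, 𝒱.N j ∈ lowering Finf 1 := fun j => by
    simpa [hΓ0, adExp] using hresidue j 0 (zero_mem_polydisc hρ) (zero_mem_polydisc one_pos) rfl
  refine ⟨min ρ 1, lt_min hρ one_pos, hd.mono (polydisc_mono (min_le_left ρ 1)),
    fun j s hs hsj => ?_⟩
  have hsρ : s ∈ polydisc r ρ := polydisc_mono (min_le_left ρ 1) hs
  exact hI.commute_of_adExp_neg_mem_lowering (hNF j)
    (hI.mem_lowering_opposite (𝒱.N_real j) (hNF j) (hM j)) (qSub_le_lowering_opposite (hq s hsρ))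
    (hresidue j s hsρ (polydisc_mono (min_le_right ρ 1) hs) hsj)

theorem adExp_monoSum {E : Type*} [NormedAddCommGroup E] [NormedSpace ℂ E] [CompleteSpace E]
    {r : ℕ} (N : Fin r → E →L[ℂ] E) (z : Fin r → ℂ) (Y : E →L[ℂ] E) :
    adExp (monoSum N z) Y = exp (∑ j, z j • continuousAd (N j)) Y := by
  simp only [adExp, ← exp_continuousAd_apply, monoSum, map_sum, map_smul]

end HodgeLimit

theorem mainTheorem7_general {E : Type*} [NormedAddCommGroup E] [NormedSpace ℂ E]
    [FiniteDimensional ℂ E] {r : ℕ} {D : PolarizedData E} {𝒱 : Variation D r}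
    {Finf M : ℤ → Submodule ℂ E} (hM : ∀ j, 𝒱.N j ∈ lowering M 2)
    {I : ℤ → ℤ → Submodule ℂ E} (hI : IsDeligneBigrading D Finf M I)
    {Γ : (Fin r → ℂ) → E →L[ℂ] E} (hΓ : 𝒱.IsLocalNormalForm Finf I Γ)
    {z : (Fin r → ℂ) → Fin r → ℂ} (hz : IsBranchChoice z) :
    Tendsto (fun s => adExp (monoSum 𝒱.N (z s)) (Γ s)) (𝓝[puncturedPolydisc r] 0) (𝓝 0) := by
  have := FiniteDimensional.complete ℂ E
  obtain ⟨ρ, hρ, hd, hcomm⟩ := hΓ.exists_commute hI hM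
  simp only [adExp_monoSum]
  exact tendsto_exp_sum_smul_apply (fun i j => commute_continuousAd (𝒱.N_comm i j))
    (fun j => isNilpotent_continuousAd (𝒱.N_nilp j)) hρ hd hΓ.1
    (fun j s hs hsj => continuousAd_apply_eq_zero_iff.2 (hcomm j s hs hsj)) nhdsWithin_le_nhds
    hz.tendsto_mul_pow

theorem mainTheorem7 {E : Type*} [NormedAddCommGroup E] [NormedSpace ℂ E]
    [FiniteDimensional ℂ E] {r : ℕ} (D : PolarizedData E) (𝒱 : Variation D r)
    (Finf M : ℤ → Submodule ℂ E) (hadm : 𝒱.IsAdmissible Finf M)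
    (I : ℤ → ℤ → Submodule ℂ E) (hI : IsDeligneBigrading D Finf M I)
    (Γ : (Fin r → ℂ) → E →L[ℂ] E) (hΓ : 𝒱.IsLocalNormalForm Finf I Γ)
    (z : (Fin r → ℂ) → Fin r → ℂ) (hz : IsBranchChoice z) :
    Tendsto (fun s => adExp (monoSum 𝒱.N (z s)) (Γ s)) (𝓝[puncturedPolydisc r] 0) (𝓝 0) :=
  mainTheorem7_general hadm.N_mem_lowering hI hΓ hz
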